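/- Let $(A,\mathfrak m)$ be a Cohen–Macaulay (Noetherian) local ring of dimension $d \ge 0$. A parameter ideal of $A$ is an $\mathfrak m$-primary ideal generated by $d$ elements. An Ulrich ideal of $A$ is an $\mathfrak m$-primary ideal $I$ that contains a parameter ideal $Q$ as a reduction such that $I^2 = QI$ and such that the $A/I$-module $I/I^2$ is free. Let $\mathcal X_A$ be the set of Ulrich ideals $I$ of $A$ with $\mu_A(I) > d$, where $\mu_A(I)$ denotes the minimal number of generators of $I$; these are exactly the Ulrich ideals of $A$ that are not parameter ideals. Suppose that $A$ has finite CM-representation type, that is, there are only finitely many isomorphism classes of indecomposable maximal Cohen–Macaulay $A$-modules (non-zero finitely generated $A$-modules $M$ with $\operatorname{depth}_A M = d$). Then the set $\mathcal X_A$ is finite. -/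

import Mathlib

open CategoryTheory

universe u

namespace UlrichFinite

/-- The depth of a module `M` over a local ring `A`: the supremum of the lengths of the
`M`-regular sequences in the maximal ideal. (It is `0` for the zero module, so the definitions
below ask for non-zero modules separately.) -/
noncomputable def depth (A : Type*) [CommRing A] [IsLocalRing A]
    (M : Type*) [AddCommGroup M] [Module A M] : ℕ∞ :=
  ⨆ (rs : List A) (_ : (∀ r ∈ rs, r ∈ IsLocalRing.maximalIdeal A) ∧
    RingTheory.Sequence.IsRegular M rs), (rs.length : ℕ∞)

/-- A Cohen–Macaulay local ring: a Noetherian local ring whose depth is its Krull dimension. -/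
structure IsCohenMacaulayLocal (A : Type*) [CommRing A] [IsLocalRing A] : Prop where
  noetherian : IsNoetherianRing A
  depth_eq : (depth A A : WithBot ℕ∞) = ringKrullDim A

/-- A maximal Cohen–Macaulay module: a non-zero finitely generated module whose depth is
`dim A`. -/
structure IsMaximalCohenMacaulay (A : Type*) [CommRing A] [IsLocalRing A]
    (M : Type*) [AddCommGroup M] [Module A M] : Prop where
  finite : Module.Finite A M
  nontrivial : Nontrivial M
  depth_eq : (depth A M : WithBot ℕ∞) = ringKrullDim A

/-- Finite CM-representation type: up to isomorphism there are only finitely many indecomposable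
maximal Cohen–Macaulay modules. (Every finitely generated module is isomorphic to one in the
universe of `A`, so it is enough to look at that universe.) -/
def HasFiniteCMType (A : Type u) [CommRing A] [IsLocalRing A] : Prop :=
  ∃ S : Set (ModuleCat.{u} A), S.Finite ∧
    ∀ M : ModuleCat.{u} A, IsMaximalCohenMacaulay A M → Indecomposable M →
      ∃ N ∈ S, Nonempty (M ≅ N)

/-- A parameter ideal: an ideal generated by `d = dim A` elements whose radical is the maximal
ideal. -/
def IsParameterIdeal {A : Type*} [CommRing A] [IsLocalRing A] (Q : Ideal A) : Prop :=
  Q.radical = IsLocalRing.maximalIdeal A ∧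
    ∃ d : ℕ, (d : WithBot ℕ∞) = ringKrullDim A ∧
      ∃ a : Fin d → A, Q = Ideal.span (Set.range a)

/-- `Q` is a reduction of `I`: `Q ⊆ I` and `I ^ (n + 1) = Q I ^ n` for some `n ≥ 0`. -/
def IsReduction {A : Type*} [CommRing A] (Q I : Ideal A) : Prop :=
  Q ≤ I ∧ ∃ n : ℕ, I ^ (n + 1) = Q * I ^ n

/-- An Ulrich ideal: an `𝔪`-primary ideal `I` (that is, of radical `𝔪`) containing a parameter
ideal `Q` as a reduction, with `I ^ 2 = Q I` and with `I / I ^ 2` free over `A / I`. -/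
def IsUlrichIdeal {A : Type*} [CommRing A] [IsLocalRing A] (I : Ideal A) : Prop :=
  I.radical = IsLocalRing.maximalIdeal A ∧
    (∃ Q : Ideal A, IsParameterIdeal Q ∧ IsReduction Q I ∧ I ^ 2 = Q * I) ∧
    Module.Free (A ⧸ I) I.Cotangent

/-- The set `𝒳_A` of the Ulrich ideals `I` with `μ_A(I) > dim A`; here `μ_A(I)` is the minimal
number of generators of `I`. -/
def nonparameterUlrichIdeals (A : Type*) [CommRing A] [IsLocalRing A] : Set (Ideal A) :=
  {I | IsUlrichIdeal I ∧ ringKrullDim A < (I.spanFinrank : WithBot ℕ∞)}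

end UlrichFinite

/-!
The proof attaches to a module `M` its stable annihilator: the ideal of the `x` in `A` such that
multiplication by `x` on `M` factors through a finite free module. The stable annihilator of a
direct sum is the intersection of those of the summands. If `S` is a finite set of representatives
of the indecomposable maximal Cohen–Macaulay modules, the stable annihilator of every maximal
Cohen–Macaulay module is thus the intersection of the stable annihilators of the members of some
subset of `S` (`exists_stableAnnihilator_eq_sInf`), and only finitely many ideals arise. It remains
to write each Ulrich ideal `I` that is not a parameter ideal as the stable annihilator of a maximal
Cohen–Macaulay module (`exists_stableAnnihilator_eq`). No bound on the number of generators of `I`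
and no uniqueness of decompositions is needed.

Let `Q = (a₁, …, a_d)` be the parameter ideal of `I`; its generators form a regular sequence,
because `A` is Cohen–Macaulay (`isWeaklyRegular_of_system_of_parameters`, which rests on the
exchange property of regular sequences and on the bound of the depth by the dimensions of the
associated primes). Starting from `A ⧸ I`, take a syzygy over `A ⧸ (a₁, …, a_{d-1})`, then a syzygy
of it over `A ⧸ (a₁, …, a_{d-2})`, and so on down to `A` itself. Each step gains one in depth, so
the last module `M` is maximal Cohen–Macaulay, and each step preserves the property that
multiplication by an element of `I` factors through a finite free module
(`IsUlrichSyzygy.exists_syzygy`).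

Conversely, let multiplication by `x` on `M` factor through a free module. The steps also carry
along an element `z` with `I z ⊆ Q M` and a map `f : M → A ⧸ I` with `f z = 1`: the next `z` is `a`
times a lift of `z`, and the next `f` is a lift of `f`, restricted to the syzygy and followed by a
functional `I → A ⧸ I` with value `1` on `a` and `0` on the preceding generators. A functional on
`M` maps `z` into `Q : I`. If `Q : I = I`, it follows that `x z` lies in `I M`, so that
`x = f (x z) = 0` in `A ⧸ I` (`IsUlrichSyzygy.stableAnnihilator_eq`).

Both the functionals and the equality `Q : I = I` come from the freeness of `I ⧸ I ^ 2`. By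
`I ^ 2 = Q I` and the regularity of the sequence, `a₁, …, a_d` are linearly independent in
`I ⧸ I ^ 2` over `A ⧸ I`; as this local ring has a non-zero socle, they are part of a basis, and a
complement is non-zero if `I ≠ Q` (`exists_dual_and_colon_le`).
-/

namespace UlrichFinite

/-! ### Regular sequences and systems of parameters -/

section RegularSequences

open RingTheory.Sequence IsLocalRing Pointwise

variable {R : Type*} [CommRing R]

lemma isWeaklyRegular_of_retract {rs : List R} {M N : Type u} [AddCommGroup M] [AddCommGroup N]
    [Module R M] [Module R N] (s : N →ₗ[R] M) (r : M →ₗ[R] N) (hrs : r ∘ₗ s = LinearMap.id)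
    (h : IsWeaklyRegular M rs) : IsWeaklyRegular N rs := by
  induction rs generalizing M N with
  | nil => exact .nil R N
  | cons a t ih =>
    rw [isWeaklyRegular_cons_iff] at h ⊢
    have hs : Function.Injective s :=
      Function.LeftInverse.injective (g := r) fun x => LinearMap.congr_fun hrs x
    refine ⟨h.1.of_injective s hs, ih (QuotSMulTop.map a s) (QuotSMulTop.map a r) ?_ h.2⟩
    rw [← QuotSMulTop.map_comp, hrs, QuotSMulTop.map_id]

/-- A syzygy gains one in depth: if `rs` is weakly regular on `M` and `rs` followed by `a` is
weakly regular on `F`, then `rs` followed by `a` is weakly regular on the kernel of a surjection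
`F → M`. -/
lemma isWeaklyRegular_append_singleton_of_exact {rs : List R} {a : R} {K F M : Type u}
    [AddCommGroup K] [AddCommGroup F] [AddCommGroup M] [Module R K] [Module R F] [Module R M]
    (i : K →ₗ[R] F) (p : F →ₗ[R] M) (hi : Function.Injective i) (hip : Function.Exact i p)
    (hp : Function.Surjective p) (hM : IsWeaklyRegular M rs) (hF : IsWeaklyRegular F (rs ++ [a])) :
    IsWeaklyRegular K (rs ++ [a]) := by
  induction rs generalizing K F M with
  | nil =>
    rw [List.nil_append, isWeaklyRegular_singleton_iff] at hF ⊢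
    exact hF.of_injective i hi
  | cons r t ih =>
    rw [List.cons_append, isWeaklyRegular_cons_iff] at hF ⊢
    rw [isWeaklyRegular_cons_iff] at hM
    refine ⟨hF.1.of_injective i hi, ih (QuotSMulTop.map r i) (QuotSMulTop.map r p) ?_
      (QuotSMulTop.map_exact r hip hp) (QuotSMulTop.map_surjective r hp) hM.2 hF.2⟩
    have h0 : Function.Exact (0 : PUnit.{u+1} →ₗ[R] K) i := by
      rw [LinearMap.exact_zero_iff_injective]; exact hi
    have h1 := QuotSMulTop.map_first_exact_on_four_term_exact_of_isSMulRegular_last h0 hip hM.1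
    rw [map_zero, LinearMap.exact_zero_iff_injective] at h1
    exact h1

lemma mk_quotSMulTop_eq_zero_iff {M : Type u} [AddCommGroup M] [Module R M] (a : R) (x : M) :
    (Submodule.Quotient.mk x : QuotSMulTop a M) = 0 ↔ ∃ t : M, a • t = x := by
  rw [Submodule.Quotient.mk_eq_zero, Submodule.mem_smul_pointwise_iff_exists]
  simp

/-- If `a` and `r` are both regular on `M`, the socles of `M / aM` and `M / rM` vanish
simultaneously. -/
lemma socle_quotSMulTop_eq_zero [IsLocalRing R] {M : Type u} [AddCommGroup M] [Module R M] {a r : R}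
    (hr : r ∈ maximalIdeal R) (ha : IsSMulRegular M a) (hreg : IsSMulRegular M r)
    (h : ∀ s : QuotSMulTop r M, (∀ y ∈ maximalIdeal R, y • s = 0) → s = 0)
    (s : QuotSMulTop a M) (hs : ∀ y ∈ maximalIdeal R, y • s = 0) : s = 0 := by
  obtain ⟨s, rfl⟩ := Submodule.Quotient.mk_surjective _ s
  simp only [← Submodule.Quotient.mk_smul, mk_quotSMulTop_eq_zero_iff] at hs ⊢
  obtain ⟨t, ht⟩ := hs r hr
  have h1 := h (Submodule.Quotient.mk t) fun y hy => by
    rw [← Submodule.Quotient.mk_smul, mk_quotSMulTop_eq_zero_iff]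
    obtain ⟨w, hw⟩ := hs y hy
    refine ⟨w, ha ?_⟩
    simp only
    rw [smul_comm, hw, smul_comm a y t, ht, smul_comm]
  rw [mk_quotSMulTop_eq_zero_iff] at h1
  obtain ⟨w, hw⟩ := h1
  refine ⟨w, hreg ?_⟩
  simp only
  rw [smul_comm, hw, ht]

variable [IsLocalRing R] [IsNoetherianRing R]

lemma exists_isSMulRegular_of_socle_eq_zero {M : Type u} [AddCommGroup M] [Module R M]
    [Module.Finite R M]
    (h : ∀ s : M, (∀ y ∈ maximalIdeal R, y • s = 0) → s = 0) :
    ∃ r ∈ maximalIdeal R, IsSMulRegular M r := by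
  have key : Subsingleton ((R ⧸ maximalIdeal R) →ₗ[R] M) := by
    refine subsingleton_of_forall_eq 0 fun f => ?_
    refine Submodule.linearMap_qext _ (LinearMap.ext_ring ?_)
    refine (h _ fun y hy => ?_).trans (by simp)
    simp only [LinearMap.comp_apply, ← map_smul]
    rw [smul_eq_mul, mul_one, Submodule.mkQ_apply, (Submodule.Quotient.mk_eq_zero _).2 hy, map_zero]
  obtain ⟨r, hr, hreg⟩ := IsSMulRegular.subsingleton_linearMap_iff.1 key
  rw [Ideal.annihilator_quotient] at hr
  exact ⟨r, hr, hreg⟩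

/-- Exchange property of regular sequences: if `M` has a weakly regular sequence of length
`n + 1` in the maximal ideal and `a` in the maximal ideal is regular on `M`, then `M / aM` has a
weakly regular sequence of length `n`. -/
lemma exists_isWeaklyRegular_quotSMulTop (n : ℕ) {M : Type u} [AddCommGroup M] [Module R M]
    [Module.Finite R M] {rs : List R} (hlen : rs.length = n + 1)
    (hmem : ∀ r ∈ rs, r ∈ maximalIdeal R) (hrs : IsWeaklyRegular M rs) {a : R}
    (ham : a ∈ maximalIdeal R) (ha : IsSMulRegular M a) :
    ∃ ts : List R, ts.length = n ∧ (∀ r ∈ ts, r ∈ maximalIdeal R) ∧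
      IsWeaklyRegular (QuotSMulTop a M) ts := by
  induction n generalizing M rs a with
  | zero => exact ⟨[], rfl, by simp, .nil R _⟩
  | succ n ih =>
    obtain _ | ⟨r, t⟩ := rs
    · simp at hlen
    obtain _ | ⟨t₀, t⟩ := t
    · simp at hlen
    rw [isWeaklyRegular_cons_iff] at hrs
    have hr : r ∈ maximalIdeal R := hmem r (by simp)
    have ht₀ : t₀ ∈ maximalIdeal R := hmem t₀ (by simp)
    have hreg₀ := ((isWeaklyRegular_cons_iff _ _ _).1 hrs.2).1
    have hsr : ∀ s : QuotSMulTop r M, (∀ y ∈ maximalIdeal R, y • s = 0) → s = 0 :=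
      fun s hs => hreg₀.right_eq_zero_of_smul (hs t₀ ht₀)
    have hsa := socle_quotSMulTop_eq_zero hr ha hrs.1 hsr
    -- an element of the maximal ideal that is regular on both `M / rM` and `M / aM`
    obtain ⟨z, hz, hzreg⟩ := exists_isSMulRegular_of_socle_eq_zero
      (M := QuotSMulTop r M × QuotSMulTop a M) (R := R) fun s hs =>
        Prod.ext (hsr _ fun y hy => congrArg Prod.fst (hs y hy))
          (hsa _ fun y hy => congrArg Prod.snd (hs y hy))
    have hzr : IsSMulRegular (QuotSMulTop r M) z :=
      hzreg.of_injective (LinearMap.inl R _ _) LinearMap.inl_injective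
    have hza : IsSMulRegular (QuotSMulTop a M) z :=
      hzreg.of_injective (LinearMap.inr R _ _) LinearMap.inr_injective
    obtain ⟨w, hwlen, hwm, hw⟩ := ih (M := QuotSMulTop r M) (rs := t₀ :: t) (by simpa using hlen)
      (fun x hx => hmem x (List.mem_cons_of_mem _ hx)) hrs.2 hz hzr
    have h1 : IsWeaklyRegular M (z :: r :: w) := by
      refine isWeaklyRegular_of_perm_of_subset_maximalIdeal (.cons hrs.1 (.cons hzr hw))
        (List.Perm.swap _ _ _) ?_
      simp only [List.mem_cons]
      rintro x (rfl | rfl | hx)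
      exacts [hr, hz, hwm x hx]
    rw [isWeaklyRegular_cons_iff] at h1
    have h2 : IsWeaklyRegular M [z, a] := by
      refine isWeaklyRegular_of_perm_of_subset_maximalIdeal (.cons ha (.cons hza (.nil R _)))
        (List.Perm.swap _ _ _) ?_
      simp only [List.mem_cons, List.not_mem_nil, or_false]
      rintro x (rfl | rfl)
      exacts [ham, hz]
    rw [isWeaklyRegular_cons_iff, isWeaklyRegular_singleton_iff] at h2
    obtain ⟨v, hvlen, hvm, hv⟩ := ih (M := QuotSMulTop z M) (rs := r :: w) (by simp [hwlen])
      (by simpa using ⟨hr, hwm⟩) h1.2 ham h2.2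
    have h3 : IsWeaklyRegular M (a :: z :: v) := by
      refine isWeaklyRegular_of_perm_of_subset_maximalIdeal (.cons h1.1 (.cons h2.2 hv))
        (List.Perm.swap _ _ _) ?_
      simp only [List.mem_cons]
      rintro x (rfl | rfl | hx)
      exacts [hz, ham, hvm x hx]
    rw [isWeaklyRegular_cons_iff] at h3
    exact ⟨z :: v, by simp [hvlen], by simpa using ⟨hz, hvm⟩, h3.2⟩

/-- The depth of a finitely generated module is at most the dimension of each of its associated
primes. -/
lemma length_le_ringKrullDim_of_mem_associatedPrimes (n : ℕ) {M : Type u} [AddCommGroup M]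
    [Module R M] [Module.Finite R M] {rs : List R} (hlen : rs.length = n)
    (hmem : ∀ r ∈ rs, r ∈ maximalIdeal R) (hrs : IsWeaklyRegular M rs) {p : Ideal R}
    (hp : p ∈ associatedPrimes R M) : (n : WithBot ℕ∞) ≤ ringKrullDim (R ⧸ p) := by
  induction n generalizing M rs p with
  | zero =>
    have := hp.isPrime
    simpa using ringKrullDim_nonneg_of_nontrivial (R := R ⧸ p)
  | succ n ih =>
    obtain _ | ⟨r, t⟩ := rs
    · simp at hlen
    rw [isWeaklyRegular_cons_iff] at hrs
    have hpp := hp.isPrime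
    have hr : r ∈ maximalIdeal R := hmem r (by simp)
    have hrp : r ∉ p := fun h => by
      have : r ∈ ⋃ q ∈ associatedPrimes R M, (q : Set R) := Set.mem_biUnion hp h
      rw [biUnion_associatedPrimes_eq_compl_regular] at this
      exact this hrs.1
    -- Nakayama: the submodule killed by `p` is not contained in `rM`, because `r` is regular
    let N : Submodule R M := Submodule.torsionBySet R M p
    have hN : ∃ x ∈ N, (Submodule.Quotient.mk x : QuotSMulTop r M) ≠ 0 := by
      by_contra! hcon
      have hN0 : N = ⊥ := by
        refine Submodule.eq_bot_of_eq_pointwise_smul_of_mem_jacobson_annihilator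
          (IsNoetherian.noetherian N) (r := r)
          (le_antisymm ?_ (Submodule.smul_le_self_of_tower r N))
          (maximalIdeal_le_jacobson _ hr)
        intro x hx
        obtain ⟨y, rfl⟩ := (mk_quotSMulTop_eq_zero_iff r x).1 (hcon x hx)
        refine Submodule.smul_mem_pointwise_smul _ _ _ ?_
        rw [Submodule.mem_torsionBySet_iff] at hx ⊢
        intro b
        refine hrs.1 ?_
        have := hx b
        simp only [smul_zero]
        rwa [smul_comm]
      obtain ⟨x, hx⟩ := (isAssociatedPrime_iff.1 hp).2
      have hxN : x ∈ N := by
        rw [Submodule.mem_torsionBySet_iff]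
        rintro ⟨b, hb⟩
        have hb' : b ∈ p := hb
        rw [hx, Submodule.mem_colon_singleton] at hb'
        simpa using hb'
      rw [hN0, Submodule.mem_bot] at hxN
      subst hxN
      exact hpp.ne_top (by rw [hx]; ext; simp [Submodule.mem_colon_singleton])
    obtain ⟨x, hxN, hx⟩ := hN
    obtain ⟨q, hq, hle⟩ := exists_le_isAssociatedPrime_of_isNoetherianRing R _ hx
    have hpq : p ≤ q := fun b hb => hle <| by
      rw [Submodule.mem_colon_singleton, ← Submodule.Quotient.mk_smul,
        (Submodule.mem_torsionBySet_iff _ _).1 hxN ⟨b, hb⟩]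
      simp
    have hrq : r ∈ q := hle <| by
      rw [Submodule.mem_colon_singleton, Submodule.mem_bot, ← Submodule.Quotient.mk_smul,
        mk_quotSMulTop_eq_zero_iff]
      exact ⟨x, rfl⟩
    have h1 := ih (M := QuotSMulTop r M) (rs := t) (by simpa using hlen)
      (fun y hy => hmem y (List.mem_cons_of_mem _ hy)) hrs.2 hq
    have h2 := ringKrullDim_succ_le_of_surjective (Ideal.Quotient.factor hpq)
      (Ideal.Quotient.factor_surjective hpq) (r := Ideal.Quotient.mk p r)
      (mem_nonZeroDivisors_of_ne_zero (by rwa [Ne, Ideal.Quotient.eq_zero_iff_mem]))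
      (by simpa [Ideal.Quotient.eq_zero_iff_mem] using hrq)
    refine le_trans ?_ h2
    push_cast
    exact add_le_add_left h1 1

/-- If `M` has a weakly regular sequence of length `d`, then every system of `d` parameters of `M`
is weakly regular on `M`. -/
lemma isWeaklyRegular_of_system_of_parameters (as : List R) {M : Type u} [AddCommGroup M]
    [Module R M] [Module.Finite R M] {rs : List R} (hlen : rs.length = as.length)
    (hmem : ∀ r ∈ rs, r ∈ maximalIdeal R) (hrs : IsWeaklyRegular M rs)
    (has : ∀ r ∈ as, r ∈ maximalIdeal R)
    (hrad : maximalIdeal R ≤ (Ideal.ofList as ⊔ Module.annihilator R M).radical) :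
    IsWeaklyRegular M as := by
  classical
  induction as generalizing M rs with
  | nil => exact .nil R M
  | cons a t ih =>
    have ham : a ∈ maximalIdeal R := has a (by simp)
    have htm : ∀ r ∈ t, r ∈ maximalIdeal R := fun r hr => has r (List.mem_cons_of_mem _ hr)
    have ha : IsSMulRegular M a := by
      -- otherwise `a` lies in an associated prime, whose dimension is then too small
      by_contra hna
      have : a ∈ ⋃ q ∈ associatedPrimes R M, (q : Set R) := by
        rw [biUnion_associatedPrimes_eq_compl_regular]; exact hna
      obtain ⟨p, hp, hap⟩ := Set.mem_iUnion₂.1 this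
      have hpp := hp.isPrime
      have h1 := length_le_ringKrullDim_of_mem_associatedPrimes _ hlen hmem hrs hp
      let S : Finset (R ⧸ p) := (t.map (Ideal.Quotient.mk p)).toFinset
      have : IsLocalRing (R ⧸ p) := .of_surjective' _ Ideal.Quotient.mk_surjective
      have hmax : (maximalIdeal (R ⧸ p)).comap (Ideal.Quotient.mk p) = maximalIdeal R :=
        eq_maximalIdeal (Ideal.comap_isMaximal_of_surjective _ Ideal.Quotient.mk_surjective)
      have hS : (S : Set (R ⧸ p)) ⊆ maximalIdeal (R ⧸ p) := by
        intro y hy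
        simp only [S, List.coe_toFinset, List.mem_map, Set.mem_ofPred_eq] at hy
        obtain ⟨x, hx, rfl⟩ := hy
        exact hmax.ge (htm x hx)
      have h2 := ringKrullDim_le_ringKrullDim_quotient_add_card S
        (by rwa [ringJacobson_eq_maximalIdeal])
      -- modulo `p` and the remaining parameters every prime ideal is maximal
      have h3 : ringKrullDim ((R ⧸ p) ⧸ Ideal.span (S : Set (R ⧸ p))) ≤ 0 := by
        let φ := (Ideal.Quotient.mk (Ideal.span (S : Set (R ⧸ p)))).comp (Ideal.Quotient.mk p)
        have hφ : Function.Surjective φ :=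
          Ideal.Quotient.mk_surjective.comp Ideal.Quotient.mk_surjective
        have hpφ : ∀ y ∈ p, φ y = 0 := fun y hy => by
          simp only [φ, RingHom.comp_apply]
          rw [Ideal.Quotient.eq_zero_iff_mem.2 hy, map_zero]
        have hker : Ideal.ofList (a :: t) ⊔ Module.annihilator R M ≤ RingHom.ker φ := by
          refine sup_le (Ideal.span_le.2 fun y hy => ?_) fun y hy =>
            hpφ y (hp.annihilator_le (by rwa [Submodule.annihilator_top]))
          obtain rfl | hy := List.mem_cons.1 hy
          · exact hpφ _ hap
          · refine Ideal.Quotient.eq_zero_iff_mem.2 (Ideal.subset_span ?_)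
            simpa [S] using ⟨y, hy, rfl⟩
        rw [← Nat.cast_zero, ← Ring.krullDimLE_iff, Ring.krullDimLE_zero_iff]
        intro P hP
        refine Ideal.isMaximal_of_isIntegral_of_isMaximal_comap' φ
          (RingHom.isIntegral_of_surjective _ hφ) P ?_
        have hle : maximalIdeal R ≤ P.comap φ := by
          refine hrad.trans ((Ideal.radical_mono hker).trans ?_)
          rw [(hP.comap φ).radical_le_iff]
          exact Ideal.comap_mono bot_le
        rw [← (maximalIdeal.isMaximal R).eq_of_le (hP.comap φ).ne_top hle]
        exact maximalIdeal.isMaximal R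
      have h4 : S.card ≤ t.length := by
        simpa [S] using List.toFinset_card_le (t.map (Ideal.Quotient.mk p))
      have h5 : ((t.length + 1 : ℕ) : WithBot ℕ∞) ≤ (t.length : ℕ) := by
        calc _ ≤ _ := h1
          _ ≤ _ := h2
          _ ≤ 0 + (t.length : WithBot ℕ∞) := add_le_add h3 (by exact_mod_cast h4)
          _ = _ := zero_add _
      have h6 : t.length + 1 ≤ t.length := by exact_mod_cast h5
      omega
    refine .cons ha ?_
    obtain ⟨ts, htlen, htsm, hts⟩ := exists_isWeaklyRegular_quotSMulTop t.length
      (by simpa using hlen) hmem hrs ham ha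
    refine ih htlen htsm hts htm (hrad.trans (Ideal.radical_mono ?_))
    rw [Ideal.ofList_cons, sup_comm (Ideal.span {a}), sup_assoc]
    refine sup_le_sup_left (sup_le ?_ ?_) _
    · rw [Ideal.span_singleton_le_iff_mem]
      exact QuotSMulTop.mem_annihilator _ a
    · exact LinearMap.annihilator_le_of_surjective (Submodule.mkQ _) (Submodule.mkQ_surjective _)

end RegularSequences

/-! ### Syzygies and endomorphisms factoring through free modules -/

section Syzygies

open RingTheory.Sequence IsLocalRing Pointwise

variable {A : Type u} [CommRing A]

/-- The endomorphisms of `M` that are sums of composites `M → P → M`. For `P = A` these are the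
endomorphisms factoring through a finite free module, and for `P = A ⧸ J` those factoring through
a finite free `A ⧸ J`-module. -/
def factoringThrough (A : Type u) [CommRing A] (P M : Type u) [AddCommGroup P] [AddCommGroup M]
    [Module A P] [Module A M] : Submodule A (M →ₗ[A] M) :=
  Submodule.span A {φ | ∃ (α : M →ₗ[A] P) (β : P →ₗ[A] M), φ = β ∘ₗ α}

variable {P M : Type u} [AddCommGroup P] [AddCommGroup M] [Module A P] [Module A M]

lemma comp_mem_factoringThrough (α : M →ₗ[A] P) (β : P →ₗ[A] M) :
    β ∘ₗ α ∈ factoringThrough A P M :=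
  Submodule.subset_span ⟨α, β, rfl⟩

lemma comp_pi_mem_factoringThrough {ι : Type*} [Fintype ι] (α : M →ₗ[A] (ι → P))
    (β : (ι → P) →ₗ[A] M) : β ∘ₗ α ∈ factoringThrough A P M := by
  classical
  have : β ∘ₗ α = ∑ i, (β ∘ₗ LinearMap.single A (fun _ => P) i) ∘ₗ (LinearMap.proj i ∘ₗ α) := by
    ext m
    simp only [LinearMap.comp_apply, LinearMap.sum_apply, ← map_sum]
    congr 1
    exact (LinearMap.sum_single_apply _ _).symm
  rw [this]
  exact Submodule.sum_mem _ fun i _ => comp_mem_factoringThrough _ _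

lemma factoringThrough_le_of_linearEquiv {P' : Type u} [AddCommGroup P'] [Module A P']
    (e : P ≃ₗ[A] P') : factoringThrough A P M ≤ factoringThrough A P' M := by
  refine Submodule.span_le.2 ?_
  rintro _ ⟨α, β, rfl⟩
  have : β ∘ₗ α = (β ∘ₗ e.symm.toLinearMap) ∘ₗ (e.toLinearMap ∘ₗ α) := by ext; simp
  rw [this]
  exact comp_mem_factoringThrough _ _

/-- If `φ` factors through `P` on `M`, then so does `r ∘ φ ∘ s` on `N`. -/
lemma conj_mem_factoringThrough {N : Type u} [AddCommGroup N] [Module A N] (s : N →ₗ[A] M)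
    (r : M →ₗ[A] N) {φ : M →ₗ[A] M} (hφ : φ ∈ factoringThrough A P M) :
    r ∘ₗ φ ∘ₗ s ∈ factoringThrough A P N := by
  induction hφ using Submodule.span_induction with
  | mem φ h =>
    obtain ⟨α, β, rfl⟩ := h
    exact comp_mem_factoringThrough (α ∘ₗ s) (r ∘ₗ β)
  | zero => simp
  | add φ ψ _ _ h1 h2 =>
    rw [LinearMap.add_comp, LinearMap.comp_add]; exact add_mem h1 h2
  | smul c φ _ h =>
    rw [LinearMap.smul_comp, LinearMap.comp_smul]; exact Submodule.smul_mem _ _ h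

/-- The universal property of the finite free `A ⧸ J`-modules among the `A`-modules killed
by `J`. -/
lemma exists_linearMap_pi_quotient {J : Ideal A} (hJ : ∀ j ∈ J, ∀ x : M, j • x = 0) {ι : Type*}
    [Fintype ι] [DecidableEq ι] (v : ι → M) :
    ∃ φ : (ι → A ⧸ J) →ₗ[A] M, ∀ i, φ (Pi.single i 1) = v i := by
  refine ⟨LinearMap.lsum A (fun _ => A ⧸ J) A fun i =>
    Submodule.liftQ J (LinearMap.toSpanSingleton A M (v i)) fun j hj => hJ j hj _, fun i => ?_⟩
  rw [LinearMap.lsum_piSingle]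
  exact (Submodule.liftQ_apply _ _ (1 : A)).trans (by simp)

lemma linearMap_pi_quotient_ext {J : Ideal A} {ι : Type*} [Fintype ι] [DecidableEq ι]
    {φ ψ : (ι → A ⧸ J) →ₗ[A] M} (h : ∀ i, φ (Pi.single i 1) = ψ (Pi.single i 1)) : φ = ψ := by
  refine LinearMap.pi_ext' fun i => Submodule.linearMap_qext _ (LinearMap.ext_ring ?_)
  exact h i

/-- Maps out of a finite free `A ⧸ J`-module lift along surjections of modules killed by `J`. -/
lemma exists_lift_pi_quotient {J : Ideal A} {N : Type u} [AddCommGroup N] [Module A N]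
    (hJ : ∀ j ∈ J, ∀ x : M, j • x = 0) {p : M →ₗ[A] N} (hp : Function.Surjective p) {ι : Type*}
    [Fintype ι] (g : (ι → A ⧸ J) →ₗ[A] N) : ∃ f : (ι → A ⧸ J) →ₗ[A] M, p ∘ₗ f = g := by
  classical
  choose v hv using fun i => hp (g (Pi.single i 1))
  obtain ⟨f, hf⟩ := exists_linearMap_pi_quotient hJ v
  exact ⟨f, linearMap_pi_quotient_ext fun i => by rw [LinearMap.comp_apply, hf, hv]⟩

lemma exists_lift_quotient {J : Ideal A} {N : Type u} [AddCommGroup N] [Module A N]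
    (hJ : ∀ j ∈ J, ∀ x : M, j • x = 0) {p : M →ₗ[A] N} (hp : Function.Surjective p)
    (g : (A ⧸ J) →ₗ[A] N) : ∃ f : (A ⧸ J) →ₗ[A] M, p ∘ₗ f = g := by
  obtain ⟨x, hx⟩ := hp (g 1)
  refine ⟨Submodule.liftQ J (LinearMap.toSpanSingleton A M x) fun j hj => hJ j hj _,
    Submodule.linearMap_qext _ (LinearMap.ext_ring ?_)⟩
  rw [LinearMap.comp_apply, LinearMap.comp_apply, LinearMap.comp_apply]
  refine Eq.trans (congrArg p (Submodule.liftQ_apply _ _ (1 : A))) ?_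
  simpa using hx

lemma exists_surjective_pi_quotient [Module.Finite A M] {J : Ideal A}
    (hJ : ∀ j ∈ J, ∀ x : M, j • x = 0) :
    ∃ (k : ℕ) (p : (Fin k → A ⧸ J) →ₗ[A] M), Function.Surjective p := by
  obtain ⟨k, v, hv⟩ := Module.Finite.exists_fin (R := A) (M := M)
  obtain ⟨p, hp⟩ := exists_linearMap_pi_quotient hJ v
  refine ⟨k, p, LinearMap.range_eq_top.1 (top_le_iff.1 ?_)⟩
  rw [← hv, Submodule.span_le]
  rintro _ ⟨i, rfl⟩
  exact ⟨_, hp i⟩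

lemma smul_pi_quotient_eq_zero {J : Ideal A} {ι : Type*} :
    ∀ j ∈ J, ∀ x : ι → A ⧸ J, j • x = 0 := by
  intro j hj x
  ext i
  obtain ⟨y, hy⟩ := Submodule.Quotient.mk_surjective _ (x i)
  rw [Pi.smul_apply, Pi.zero_apply, ← hy, ← Submodule.Quotient.mk_smul,
    Submodule.Quotient.mk_eq_zero]
  exact J.mul_mem_right _ hj

lemma isWeaklyRegular_pi {k : ℕ} {rs : List A} (h : IsWeaklyRegular M rs) :
    IsWeaklyRegular (Fin k → M) rs := by
  have h1 := h.isWeaklyRegular_rTensor (M₂ := Fin k → A)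
  exact ((TensorProduct.piScalarRight A A M (Fin k)).isWeaklyRegular_congr rs).1 h1

lemma exists_comp_eq_of_ker_le {N L : Type*} [AddCommGroup N] [AddCommGroup L] [Module A N]
    [Module A L] {q : M →ₗ[A] N} (hq : Function.Surjective q) (g : M →ₗ[A] L)
    (h : LinearMap.ker q ≤ LinearMap.ker g) : ∃ g' : N →ₗ[A] L, g' ∘ₗ q = g := by
  refine ⟨(LinearMap.ker q).liftQ g h ∘ₗ (q.quotKerEquivOfSurjective hq).symm.toLinearMap, ?_⟩
  ext x
  have : (q.quotKerEquivOfSurjective hq).symm (q x) = Submodule.Quotient.mk x := by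
    rw [LinearEquiv.symm_apply_eq]; rfl
  simp [this]

/-- The properties of the iterated syzygies of `A ⧸ I` on which the argument rests. Here `I`
contains `Q = J + (rs)`, and `M` is a module over `A ⧸ J` on which `rs` is weakly regular. The
element `z` spans a copy of `A ⧸ I` that splits off `M ⧸ (rs) M`, and multiplication by each
element of `I` factors through a finite free `A ⧸ J`-module. All modules are regarded as
`A`-modules, so that `J` may vary. -/
structure IsUlrichSyzygy (I J : Ideal A) (rs : List A) (M : Type u) [AddCommGroup M]
    [Module A M] : Prop where
  finite : Module.Finite A M
  smul_eq_zero : ∀ j ∈ J, ∀ x : M, j • x = 0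
  isWeaklyRegular : IsWeaklyRegular M rs
  exists_splitting : ∃ (z : M) (f : M →ₗ[A] A ⧸ I), f z = 1 ∧
    ∀ x ∈ I, x • z ∈ (Ideal.ofList rs • ⊤ : Submodule A M)
  smul_id_mem : ∀ x ∈ I, x • LinearMap.id ∈ factoringThrough A (A ⧸ J) M

/-- An endomorphism `φ` of `M` that factors through a finite free `A ⧸ (J + (a))`-module lifts to
an endomorphism `Φ` of the free `A ⧸ J`-module covering `M`, whose restriction to the syzygy factors
through a finite free `A ⧸ J`-module. -/
lemma exists_lift_factoringThrough {J : Ideal A} {a : A} (ha : IsSMulRegular (A ⧸ J) a) {k : ℕ}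
    {p : (Fin k → A ⧸ J) →ₗ[A] M} (hp : Function.Surjective p)
    (hM : ∀ j ∈ J ⊔ Ideal.span {a}, ∀ x : M, j • x = 0) {φ : M →ₗ[A] M}
    (hφ : φ ∈ factoringThrough A (A ⧸ (J ⊔ Ideal.span {a})) M) :
    ∃ (Φ : (Fin k → A ⧸ J) →ₗ[A] (Fin k → A ⧸ J)) (ψ : LinearMap.ker p →ₗ[A] LinearMap.ker p),
      p ∘ₗ Φ = φ ∘ₗ p ∧ (∀ m, (ψ m : Fin k → A ⧸ J) = Φ m) ∧
      ψ ∈ factoringThrough A (A ⧸ J) (LinearMap.ker p) := by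
  induction hφ using Submodule.span_induction with
  | mem φ h =>
    obtain ⟨α, β, rfl⟩ := h
    let π : (A ⧸ J) →ₗ[A] A ⧸ (J ⊔ Ideal.span {a}) := Submodule.factor le_sup_left
    have hπ : Function.Surjective π := Submodule.factor_surjective _
    obtain ⟨b, hb⟩ := exists_lift_quotient (J := J) smul_pi_quotient_eq_zero hp (β ∘ₗ π)
    obtain ⟨c, hc⟩ := exists_lift_pi_quotient (J := J) (M := A ⧸ J) (p := π)
      (fun j hj x => congrFun (smul_pi_quotient_eq_zero (ι := Unit) j hj fun _ => x) ())
      hπ (α ∘ₗ p)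
    -- the kernel of `π` is `a (A ⧸ J)`, which is isomorphic to `A ⧸ J`
    have hker : ∀ y, π y = 0 → ∃ t, a • t = y := by
      intro y hy
      obtain ⟨y, rfl⟩ := Submodule.Quotient.mk_surjective _ y
      have hy' : y ∈ J ⊔ Ideal.span {a} := (Submodule.Quotient.mk_eq_zero _).1 hy
      obtain ⟨j, hj, w, hw, rfl⟩ := Submodule.mem_sup.1 hy'
      obtain ⟨t, rfl⟩ := Ideal.mem_span_singleton'.1 hw
      refine ⟨Submodule.Quotient.mk t, ?_⟩
      rw [← Submodule.Quotient.mk_smul, Submodule.Quotient.eq]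
      simpa [mul_comm] using hj
    let e := LinearEquiv.ofInjective (LinearMap.lsmul A (A ⧸ J) a) ha
    have hcK : ∀ m : LinearMap.ker p, c m ∈ LinearMap.range (LinearMap.lsmul A (A ⧸ J) a) := by
      intro m
      refine hker _ ?_
      have := LinearMap.congr_fun hc m
      simpa [LinearMap.mem_ker.1 m.2] using this
    let c' : LinearMap.ker p →ₗ[A] A ⧸ J :=
      e.symm.toLinearMap ∘ₗ (c ∘ₗ (LinearMap.ker p).subtype).codRestrict _ hcK
    have hc' : ∀ m, a • c' m = c m := fun m =>
      congrArg Subtype.val (e.apply_symm_apply ⟨c m, hcK m⟩)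
    have hbK : ∀ y, (b ∘ₗ LinearMap.lsmul A (A ⧸ J) a) y ∈ LinearMap.ker p := by
      intro y
      have h1 := LinearMap.congr_fun hb (a • y)
      simp only [LinearMap.comp_apply] at h1
      rw [LinearMap.mem_ker, LinearMap.comp_apply, LinearMap.lsmul_apply, h1, map_smul, map_smul]
      exact hM a (le_sup_right (a := J) (Ideal.mem_span_singleton_self a)) _
    let b' : (A ⧸ J) →ₗ[A] LinearMap.ker p := LinearMap.codRestrict _ _ hbK
    refine ⟨b ∘ₗ c, b' ∘ₗ c', ?_, fun m => ?_, comp_mem_factoringThrough _ _⟩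
    · rw [← LinearMap.comp_assoc, hb, LinearMap.comp_assoc, hc, LinearMap.comp_assoc]
    · exact congrArg b (hc' m)
  | zero => exact ⟨0, 0, by simp, by simp, zero_mem _⟩
  | add φ φ' _ _ h1 h2 =>
    obtain ⟨Φ, ψ, h11, h12, h13⟩ := h1
    obtain ⟨Φ', ψ', h21, h22, h23⟩ := h2
    exact ⟨Φ + Φ', ψ + ψ', by rw [LinearMap.comp_add, LinearMap.add_comp, h11, h21],
      fun m => by simp [h12, h22], add_mem h13 h23⟩
  | smul r φ _ h =>
    obtain ⟨Φ, ψ, h1, h2, h3⟩ := h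
    exact ⟨r • Φ, r • ψ, by rw [LinearMap.comp_smul, LinearMap.smul_comp, h1],
      fun m => by simp [h2], Submodule.smul_mem _ _ h3⟩

/-- The syzygy step: if `M` over `A ⧸ (J + (a))` has the required properties, then so does its
syzygy over `A ⧸ J`. The functional `g` on `I` carries the splitting over. -/
lemma IsUlrichSyzygy.exists_syzygy [IsLocalRing A] [IsNoetherianRing A] {I J : Ideal A} {a : A}
    {rs : List A} (hJI : J ≤ I) (haI : a ∈ I) (g : I →ₗ[A] A ⧸ I) (hga : g ⟨a, haI⟩ = 1)
    (hgJ : ∀ y : I, (y : A) ∈ J → g y = 0) (hreg : IsWeaklyRegular (A ⧸ J) (a :: rs))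
    (hmem : ∀ r ∈ a :: rs, r ∈ maximalIdeal A)
    (hM : IsUlrichSyzygy I (J ⊔ Ideal.span {a}) rs M) :
    ∃ (K : Type u) (_ : AddCommGroup K) (_ : Module A K), IsUlrichSyzygy I J (a :: rs) K := by
  have := hM.finite
  have hJM : ∀ j ∈ J, ∀ x : M, j • x = 0 := fun j hj => hM.smul_eq_zero j (le_sup_left (a := J) hj)
  obtain ⟨k, p, hp⟩ := exists_surjective_pi_quotient hJM
  have hperm : (a :: rs).Perm (rs ++ [a]) := (List.perm_append_singleton a rs).symm
  have hmem' : ∀ r ∈ rs ++ [a], r ∈ maximalIdeal A := fun r hr => hmem r (hperm.mem_iff.2 hr)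
  have hK := isWeaklyRegular_append_singleton_of_exact (LinearMap.ker p).subtype p
    (Submodule.injective_subtype _) (LinearMap.exact_subtype_ker_map p) hp hM.isWeaklyRegular
    (isWeaklyRegular_of_perm_of_subset_maximalIdeal (isWeaklyRegular_pi hreg) hperm hmem)
  -- `a` kills `M`, so `aF` lies in the syzygy; the new distinguished element is `a` times a lift
  -- of the old one
  have haF : ∀ y, (a • LinearMap.id : (Fin k → A ⧸ J) →ₗ[A] _) y ∈ LinearMap.ker p := fun y => by
    rw [LinearMap.mem_ker, LinearMap.smul_apply, LinearMap.id_apply, map_smul]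
    exact hM.smul_eq_zero a (le_sup_right (a := J) (Ideal.mem_span_singleton_self a)) _
  let μ : (Fin k → A ⧸ J) →ₗ[A] LinearMap.ker p := LinearMap.codRestrict _ _ haF
  refine ⟨LinearMap.ker p, inferInstance, inferInstance, inferInstance, fun j hj x => ?_,
    isWeaklyRegular_of_perm_of_subset_maximalIdeal hK hperm.symm hmem', ?_, fun x hx => ?_⟩
  · exact Subtype.ext (smul_pi_quotient_eq_zero j hj _)
  · obtain ⟨z, f, hfz, hIz⟩ := hM.exists_splitting
    obtain ⟨w, rfl⟩ := hp z
    let θ : (A ⧸ J) →ₗ[A] A ⧸ I := Submodule.factor hJI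
    obtain ⟨f', hf'⟩ := exists_lift_pi_quotient (J := J) (M := A ⧸ J) (p := θ)
      (fun j hj x => congrFun (smul_pi_quotient_eq_zero (ι := Unit) j hj fun _ => x) ())
      (Submodule.factor_surjective _) (f ∘ₗ p)
    -- `g` descends to `I ⧸ J`, the kernel of `θ`
    have hq0 : ∀ y : I, (J.mkQ ∘ₗ I.subtype) y ∈ LinearMap.ker θ := fun y =>
      (Submodule.Quotient.mk_eq_zero I).2 y.2
    let q : I →ₗ[A] LinearMap.ker θ := LinearMap.codRestrict _ _ hq0
    have hq : Function.Surjective q := by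
      rintro ⟨y, hy⟩
      obtain ⟨y, rfl⟩ := Submodule.Quotient.mk_surjective _ y
      exact ⟨⟨y, (Submodule.Quotient.mk_eq_zero I).1 hy⟩, rfl⟩
    obtain ⟨g', hg'⟩ := exists_comp_eq_of_ker_le hq g fun y hy => hgJ y <|
      (Submodule.Quotient.mk_eq_zero J).1 (congrArg Subtype.val (LinearMap.mem_ker.1 hy))
    have hf'K : ∀ m ∈ LinearMap.ker p, f' m ∈ LinearMap.ker θ := fun m hm => by
      have := LinearMap.congr_fun hf' m
      simpa [LinearMap.mem_ker.1 hm] using this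
    refine ⟨μ w, g' ∘ₗ f'.restrict hf'K, ?_, fun x hx => ?_⟩
    · obtain ⟨b, hb⟩ := Submodule.Quotient.mk_surjective _ (f' w)
      have hb1 : (Submodule.Quotient.mk b : A ⧸ I) = 1 := by
        rw [← hfz]
        refine Eq.trans ?_ (LinearMap.congr_fun hf' w)
        rw [LinearMap.comp_apply, ← hb]
        rfl
      have h1 : f'.restrict hf'K (μ w) = b • q ⟨a, haI⟩ := by
        refine Subtype.ext ?_
        have h2 : f' (a • w) = b • (Submodule.Quotient.mk a : A ⧸ J) := by
          rw [map_smul, ← hb, ← Submodule.Quotient.mk_smul, ← Submodule.Quotient.mk_smul,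
            smul_eq_mul, smul_eq_mul, mul_comm]
        exact h2
      rw [LinearMap.comp_apply, h1, map_smul, ← LinearMap.comp_apply, hg', hga, ← hb1,
        ← Submodule.Quotient.mk_smul, smul_eq_mul]
      change Ideal.Quotient.mk I (b * b) = Ideal.Quotient.mk I b
      rw [map_mul]
      change Ideal.Quotient.mk I b = 1 at hb1
      rw [hb1, one_mul]
    · have h1 := hIz x hx
      have h2 : (Ideal.ofList rs • ⊤ : Submodule A M) =
          (Ideal.ofList rs • (⊤ : Submodule A (Fin k → A ⧸ J))).map p := by
        rw [Submodule.map_smul'', Submodule.map_top, LinearMap.range_eq_top.2 hp]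
      rw [h2, ← map_smul] at h1
      obtain ⟨y, hy, hyw⟩ := h1
      have hm : x • w - y ∈ LinearMap.ker p := by rw [LinearMap.mem_ker, map_sub, hyw, sub_self]
      have h3 : x • μ w = μ y + a • ⟨x • w - y, hm⟩ := by
        refine Subtype.ext ?_
        change x • a • w = a • y + a • (x • w - y)
        rw [smul_sub, smul_comm x a w]; abel
      rw [h3]
      refine add_mem ?_ (Submodule.smul_mem_smul (Ideal.subset_span (by simp)) trivial)
      have h4 := Submodule.mem_map_of_mem (f := μ) hy
      rw [Submodule.map_smul''] at h4
      refine Submodule.smul_mono ?_ le_top h4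
      rw [Ideal.ofList_cons]
      exact le_sup_right
  · obtain ⟨Φ, ψ, h1, h2, h3⟩ := exists_lift_factoringThrough
      ((isWeaklyRegular_cons_iff _ _ _).1 hreg).1 hp hM.smul_eq_zero (hM.smul_id_mem x hx)
    -- `Φ` lifts multiplication by `x` on `M`, so `x - Φ` maps `F` to the syzygy
    have he : ∀ y, (x • (LinearMap.id : (Fin k → A ⧸ J) →ₗ[A] _) - Φ) y ∈ LinearMap.ker p :=
        fun y => by
      have := LinearMap.congr_fun h1 y
      simp only [LinearMap.comp_apply, LinearMap.smul_apply, LinearMap.id_apply] at this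
      simp [this]
    have h4 : (x • LinearMap.id : LinearMap.ker p →ₗ[A] LinearMap.ker p) =
        LinearMap.codRestrict _ _ he ∘ₗ (LinearMap.ker p).subtype + ψ := by
      ext m : 2
      simp [h2]
    rw [h4]
    exact add_mem (comp_pi_mem_factoringThrough _ _) h3

/-- Let `I` contain a regular sequence `pre ++ suf` such that each of its members is split off
`I` by a functional to `A ⧸ I` that kills the preceding ones. Then the iterated syzygy of `A ⧸ I`
over the rings `A ⧸ (a₁, …, aᵢ)` has the required properties. -/
lemma exists_isUlrichSyzygy [IsLocalRing A] [IsNoetherianRing A] {I : Ideal A} (suf pre : List A)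
    (hI : ∀ r ∈ pre ++ suf, r ∈ I) (hIm : I ≤ maximalIdeal A)
    (hreg : IsWeaklyRegular A (pre ++ suf))
    (hg : ∀ (l l' : List A) (a : A) (haI : a ∈ I), pre ++ suf = l ++ a :: l' →
      ∃ g : I →ₗ[A] A ⧸ I, g ⟨a, haI⟩ = 1 ∧ ∀ y : I, (y : A) ∈ Ideal.ofList l → g y = 0) :
    ∃ (M : Type u) (_ : AddCommGroup M) (_ : Module A M),
      IsUlrichSyzygy I (Ideal.ofList pre) suf M := by
  induction suf generalizing pre with
  | nil =>
    have hkill : ∀ x ∈ I, ∀ y : A ⧸ I, x • y = 0 := fun x hx y => by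
      simpa using congrFun (smul_pi_quotient_eq_zero (ι := Unit) x hx fun _ => y) ()
    refine ⟨A ⧸ I, inferInstance, inferInstance, inferInstance, fun j hj => hkill j ?_,
      .nil A _, ⟨1, LinearMap.id, rfl, fun x hx => by rw [hkill x hx]; exact zero_mem _⟩,
      fun x hx => ?_⟩
    · exact Ideal.span_le.2 (fun r hr => hI r (by simpa using hr)) hj
    · have : (x • LinearMap.id : (A ⧸ I) →ₗ[A] A ⧸ I) = 0 := LinearMap.ext fun y => hkill x hx y
      rw [this]; exact zero_mem _
  | cons a suf ih =>
    have hsplit : pre ++ a :: suf = (pre ++ [a]) ++ suf := by simp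
    obtain ⟨M, _, _, hM⟩ := ih (pre ++ [a]) (by rwa [← hsplit]) (by rwa [← hsplit])
      (by rwa [← hsplit])
    have haI : a ∈ I := hI a (by simp)
    obtain ⟨g, hga, hgJ⟩ := hg pre suf a haI rfl
    rw [Ideal.ofList_append, Ideal.ofList_singleton] at hM
    refine hM.exists_syzygy (Ideal.span_le.2 fun r hr => hI r (List.mem_append_left _ hr)) haI g hga
      hgJ ?_ fun r hr => hIm (hI r (List.mem_append_right _ hr))
    have h1 := ((isWeaklyRegular_append_iff A _ _).1 hreg).2
    refine ((Submodule.quotEquivOfEq _ _ ?_).isWeaklyRegular_congr _).1 h1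
    simp

end Syzygies

/-! ### The conormal module of an Ulrich ideal -/

section ConormalModule

open RingTheory.Sequence IsLocalRing

/-- The coefficients of a relation among the members of a regular sequence lie in the ideal
generated by the sequence. -/
lemma coeff_mem_span_of_isWeaklyRegular {A : Type u} [CommRing A] {d : ℕ} {a : Fin d → A}
    (h : IsWeaklyRegular A (List.ofFn a)) {c : Fin d → A} (hc : ∑ i, c i * a i = 0) (i : Fin d) :
    c i ∈ Ideal.span (Set.range a) := by
  induction d with
  | zero => exact i.elim0
  | succ d ih =>
    let b : Fin d → A := fun j => a j.castSucc
    have hb : Ideal.ofList (List.ofFn b) = Ideal.span (Set.range b) := by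
      simp only [Ideal.ofList, List.mem_ofFn']; rfl
    have hle : Ideal.span (Set.range b) ≤ Ideal.span (Set.range a) :=
      Ideal.span_mono (Set.range_subset_iff.2 fun j => ⟨j.castSucc, rfl⟩)
    rw [List.ofFn_succ_last, isWeaklyRegular_append_iff, isWeaklyRegular_singleton_iff] at h
    obtain ⟨h1, h2⟩ := h
    rw [isSMulRegular_quotient_iff_mem_of_smul_mem] at h2
    rw [Fin.sum_univ_castSucc] at hc
    have hlast : c (Fin.last d) ∈ Ideal.span (Set.range b) := by
      have := h2 (c (Fin.last d)) (by
        have h3 : a (Fin.last d) • c (Fin.last d) =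
            -∑ j : Fin d, c j.castSucc * a j.castSucc := by
          rw [smul_eq_mul]; linear_combination hc
        rw [h3, smul_eq_mul, Ideal.mul_top]
        change _ ∈ Ideal.ofList (List.ofFn b)
        rw [hb]
        exact neg_mem (sum_mem fun j _ => Ideal.mul_mem_left _ _ (Ideal.subset_span ⟨j, rfl⟩)))
      rw [smul_eq_mul, Ideal.mul_top] at this
      exact hb ▸ this
    refine Fin.lastCases (hle hlast) (fun j => ?_) i
    obtain ⟨v, hv⟩ := Ideal.mem_span_range_iff_exists_fun.1 hlast
    have h3 := ih h1 (c := fun j => c j.castSucc + v j * a (Fin.last d)) (by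
      rw [← hc, ← hv, Finset.sum_mul, ← Finset.sum_add_distrib]
      exact Finset.sum_congr rfl fun j _ => by ring) j
    have h4 : c j.castSucc = (c j.castSucc + v j * a (Fin.last d)) - v j * a (Fin.last d) := by ring
    rw [h4]
    exact sub_mem (hle h3) (Ideal.mul_mem_left _ _ (Ideal.subset_span ⟨_, rfl⟩))

/-- If the socle of a local ring `R` is non-zero, every injection from a finite free module into
another one splits. -/
lemma exists_leftInverse_of_socle_ne_zero {R : Type u} [CommRing R] [IsLocalRing R] {F : Type u}
    [AddCommGroup F] [Module R F] [Module.Finite R F] [Module.Free R F] {d : ℕ}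
    {l : (Fin d → R) →ₗ[R] F} (hl : Function.Injective l) {s : R} (hs : s ≠ 0)
    (hsm : ∀ y ∈ maximalIdeal R, s * y = 0) :
    ∃ ρ : F →ₗ[R] (Fin d → R), ρ ∘ₗ l = LinearMap.id := by
  rw [IsLocalRing.split_injective_iff_lTensor_residueField_injective,
    ← LinearMap.ker_eq_bot, LinearMap.ker_eq_bot']
  intro t ht
  obtain ⟨c, rfl⟩ := TensorProduct.mk_surjective R (Fin d → R) (ResidueField R)
    residue_surjective t
  rw [TensorProduct.mk_apply, LinearMap.lTensor_tmul] at ht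
  have h1 : l c ∈ (maximalIdeal R • ⊤ : Submodule R F) := by
    rw [← LinearMap.ker_tensorProductMk]
    exact ht
  have h2 : s • l c = 0 := by
    refine Submodule.smul_induction_on h1 (fun y hy x _ => ?_) fun x y hx hy => ?_
    · rw [smul_smul, hsm y hy, zero_smul]
    · rw [smul_add, hx, hy, add_zero]
  rw [← map_smul] at h2
  have h3 : s • c = 0 := hl (h2.trans (map_zero l).symm)
  have h4 : c ∈ (maximalIdeal R • ⊤ : Submodule R (Fin d → R)) := by
    rw [pi_eq_sum_univ' c]
    refine sum_mem fun i _ => Submodule.smul_mem_smul ?_ trivial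
    rw [mem_maximalIdeal, mem_nonunits_iff]
    intro hu
    exact hs (hu.mul_left_eq_zero.1 (congrFun h3 i))
  rw [← LinearMap.ker_tensorProductMk] at h4
  exact h4

lemma exists_notMem_mul_mem_of_radical_eq {A : Type u} [CommRing A] [IsLocalRing A]
    [IsNoetherianRing A] {I : Ideal A} (hI : I.radical = maximalIdeal A) :
    ∃ s ∉ I, ∀ y ∈ maximalIdeal A, s * y ∈ I := by
  classical
  have hex : ∃ n, maximalIdeal A ^ n ≤ I :=
    Ideal.exists_pow_le_of_le_radical_of_fg hI.ge (IsNoetherian.noetherian _)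
  rcases hn : Nat.find hex with _ | n
  · have h := Nat.find_spec hex
    rw [hn, pow_zero, Ideal.one_eq_top, top_le_iff] at h
    rw [h, Ideal.radical_top] at hI
    exact absurd hI.symm (maximalIdeal.isMaximal A).ne_top
  -- an element of the last power of the maximal ideal that is not contained in `I`
  · have h1 := Nat.find_min hex (m := n) (by omega)
    obtain ⟨s, hs, hsI⟩ := SetLike.not_le_iff_exists.1 h1
    refine ⟨s, hsI, fun y hy => Nat.find_spec hex ?_⟩
    rw [hn, pow_succ]
    exact Ideal.mul_mem_mul hs hy

/-- Let `I` be an Ulrich ideal whose parameter ideal `Q` is generated by a regular sequence `a`.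
Then `a` is part of a basis of `I ⧸ I ^ 2`, and if `I ≠ Q`, then `Q : I = I`. -/
lemma exists_dual_and_colon_le {A : Type u} [CommRing A] [IsLocalRing A] [IsNoetherianRing A]
    {I : Ideal A} (hI : I.radical = maximalIdeal A) [hfree : Module.Free (A ⧸ I) I.Cotangent]
    {d : ℕ} {a : Fin d → A} (ha : IsWeaklyRegular A (List.ofFn a)) (haI : ∀ i, a i ∈ I)
    (hI2 : I ^ 2 = Ideal.span (Set.range a) * I) :
    (∃ ρ : I →ₗ[A] (Fin d → A ⧸ I), ∀ i, ρ ⟨a i, haI i⟩ = Pi.single i 1) ∧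
    (I ≠ Ideal.span (Set.range a) →
      ∀ y, (∀ x ∈ I, y * x ∈ Ideal.span (Set.range a)) → y ∈ I) := by
  classical
  set Q := Ideal.span (Set.range a) with hQ
  have hQI : Q ≤ I := Ideal.span_le.2 (Set.range_subset_iff.2 haI)
  obtain ⟨s, hsI, hs⟩ := exists_notMem_mul_mem_of_radical_eq hI
  have hItop : I ≠ ⊤ := fun h => hsI (h ▸ trivial)
  have : Nontrivial (A ⧸ I) := Ideal.Quotient.nontrivial_iff.2 hItop
  have : IsLocalRing (A ⧸ I) := .of_surjective' _ Ideal.Quotient.mk_surjective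
  have hmax : (maximalIdeal (A ⧸ I)).comap (Ideal.Quotient.mk I) = maximalIdeal A :=
    eq_maximalIdeal (Ideal.comap_isMaximal_of_surjective _ Ideal.Quotient.mk_surjective)
  have : Module.Finite (A ⧸ I) I.Cotangent := by
    have : Module.Finite A I.Cotangent := Module.Finite.of_surjective _ I.toCotangent_surjective
    exact Module.Finite.of_restrictScalars_finite A _ _
  have hsmul : ∀ (r : A) (v : I.Cotangent), Ideal.Quotient.mk I r • v = r • v := fun r v => rfl
  let l : (Fin d → A ⧸ I) →ₗ[A ⧸ I] I.Cotangent :=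
    Fintype.linearCombination (A ⧸ I) fun i => I.toCotangent ⟨a i, haI i⟩
  have hl_mk : ∀ r : Fin d → A, l (fun i => Ideal.Quotient.mk I (r i)) =
      I.toCotangent (∑ i, r i • ⟨a i, haI i⟩) := fun r => by
    simp only [l, Fintype.linearCombination_apply, hsmul, map_sum, map_smul]
  have hl : Function.Injective l := by
    rw [← LinearMap.ker_eq_bot, LinearMap.ker_eq_bot']
    intro c hc
    choose r hr using fun i => Ideal.Quotient.mk_surjective (c i)
    obtain rfl : (fun i => Ideal.Quotient.mk I (r i)) = c := funext hr
    rw [hl_mk, Ideal.toCotangent_eq_zero, hI2, mul_comm, ← smul_eq_mul, hQ,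
      Submodule.mem_ideal_smul_span_iff_exists_sum] at hc
    obtain ⟨y, hy, hyr⟩ := hc
    rw [Finsupp.sum_fintype _ _ (by simp)] at hyr
    -- the relation `∑ (rᵢ - yᵢ) aᵢ = 0` with `yᵢ ∈ I`
    have h1 := coeff_mem_span_of_isWeaklyRegular ha (c := fun i => r i - y i) (by
      simp only [sub_mul, Finset.sum_sub_distrib]
      rw [sub_eq_zero]
      simpa using hyr.symm)
    ext i
    refine Ideal.Quotient.eq_zero_iff_mem.2 ?_
    have := add_mem (hQI (h1 i)) (hy i)
    simpa using this
  obtain ⟨ρ, hρ⟩ := exists_leftInverse_of_socle_ne_zero hl (s := Ideal.Quotient.mk I s)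
    (by rwa [Ne, Ideal.Quotient.eq_zero_iff_mem]) fun y hy => by
      obtain ⟨y, rfl⟩ := Ideal.Quotient.mk_surjective y
      rw [← map_mul, Ideal.Quotient.eq_zero_iff_mem]
      exact hs y (hmax.le hy)
  have hρl : ∀ c, ρ (l c) = c := fun c => LinearMap.congr_fun hρ c
  refine ⟨⟨ρ.restrictScalars A ∘ₗ I.toCotangent, fun i => ?_⟩, fun hne y hy => ?_⟩
  · have h1 : l (Pi.single i 1) = I.toCotangent ⟨a i, haI i⟩ := by
      simp [l, Fintype.linearCombination_apply_single]
    rw [LinearMap.comp_apply, ← h1]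
    exact hρl _
  · -- the complement of the span of `a` in `I ⧸ I ^ 2` is free, non-zero and killed by `y`
    have hCfree : Module.Free (A ⧸ I) (LinearMap.ker ρ) := by
      have : Module.Projective (A ⧸ I) (LinearMap.ker ρ) := by
        refine Module.Projective.of_split (LinearMap.ker ρ).subtype
          (LinearMap.codRestrict _ (LinearMap.id - l ∘ₗ ρ) fun v => ?_) ?_
        · simp [hρl]
        · ext v
          simp
      exact Module.free_of_flat_of_isLocalRing
    have hCne : Nontrivial (LinearMap.ker ρ) := by
      by_contra hC
      rw [not_nontrivial_iff_subsingleton, Submodule.subsingleton_iff_eq_bot,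
        LinearMap.ker_eq_bot] at hC
      refine hne (le_antisymm (fun x hx => ?_) hQI)
      obtain ⟨r, hr⟩ : ∃ r : Fin d → A, (fun i => Ideal.Quotient.mk I (r i)) =
          ρ (I.toCotangent ⟨x, hx⟩) := by
        choose r hr using fun i => Ideal.Quotient.mk_surjective (ρ (I.toCotangent ⟨x, hx⟩) i)
        exact ⟨r, funext hr⟩
      have h1 : I.toCotangent ⟨x, hx⟩ = l (ρ (I.toCotangent ⟨x, hx⟩)) := hC (hρl _).symm
      rw [← hr, hl_mk, Ideal.toCotangent_eq, hI2] at h1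
      have h2 : ((∑ i, r i • (⟨a i, haI i⟩ : I) : I) : A) ∈ Q := by
        simp only [AddSubmonoidClass.coe_finsetSum, SetLike.val_smul]
        exact sum_mem fun i _ => Ideal.mul_mem_left _ _ (Ideal.subset_span ⟨i, rfl⟩)
      have := add_mem (Ideal.mul_le_left h1) h2
      simpa using this
    let b := Module.Free.chooseBasis (A ⧸ I) (LinearMap.ker ρ)
    obtain ⟨i⟩ := b.index_nonempty
    have hyC : ∀ v ∈ LinearMap.ker ρ, Ideal.Quotient.mk I y • v = 0 := by
      intro v hv
      obtain ⟨⟨x, hx⟩, rfl⟩ := I.toCotangent_surjective v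
      obtain ⟨w, hw⟩ := Ideal.mem_span_range_iff_exists_fun.1 (hy x hx)
      have h1 : Ideal.Quotient.mk I y • I.toCotangent ⟨x, hx⟩ =
          l (fun i => Ideal.Quotient.mk I (w i)) := by
        rw [hl_mk, hsmul, ← map_smul]
        congr 1
        refine Subtype.ext ?_
        simp only [AddSubmonoidClass.coe_finsetSum, SetLike.val_smul, smul_eq_mul]
        exact hw.symm
      have h2 := congrArg ρ h1
      rw [hρl, map_smul, LinearMap.mem_ker.1 hv, smul_zero] at h2
      rw [h1, ← h2, map_zero]
    have h1 : Ideal.Quotient.mk I y • b i = 0 := Subtype.ext (hyC _ (b i).2)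
    have h2 := congrArg (fun v => b.repr v i) h1
    simp only [map_smul, Module.Basis.repr_self, Finsupp.smul_single, smul_eq_mul, mul_one,
      Finsupp.single_eq_same, map_zero, Finsupp.zero_apply] at h2
    exact Ideal.Quotient.eq_zero_iff_mem.1 h2

end ConormalModule

/-! ### The stable annihilator -/

section StableAnnihilator

open RingTheory.Sequence IsLocalRing

variable {A : Type u} [CommRing A]

/-- The ideal of the `x` in `A` such that multiplication by `x` on `M` factors through a finite
free module. -/
def stableAnnihilator (A : Type u) [CommRing A] (M : Type u) [AddCommGroup M] [Module A M] :
    Ideal A :=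
  (factoringThrough A A M).comap (LinearMap.toSpanSingleton A (M →ₗ[A] M) LinearMap.id)

variable {M N : Type u} [AddCommGroup M] [Module A M] [AddCommGroup N] [Module A N]

lemma mem_stableAnnihilator {x : A} :
    x ∈ stableAnnihilator A M ↔ x • LinearMap.id ∈ factoringThrough A A M := Iff.rfl

lemma stableAnnihilator_le_of_retract (s : N →ₗ[A] M) (r : M →ₗ[A] N)
    (h : r ∘ₗ s = LinearMap.id) : stableAnnihilator A M ≤ stableAnnihilator A N := by
  intro x hx
  have := conj_mem_factoringThrough s r (mem_stableAnnihilator.1 hx)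
  rwa [LinearMap.smul_comp, LinearMap.id_comp, LinearMap.comp_smul, h] at this

lemma stableAnnihilator_congr (e : M ≃ₗ[A] N) : stableAnnihilator A M = stableAnnihilator A N :=
  le_antisymm (stableAnnihilator_le_of_retract e.symm.toLinearMap e.toLinearMap (by ext; simp))
    (stableAnnihilator_le_of_retract e.toLinearMap e.symm.toLinearMap (by ext; simp))

lemma stableAnnihilator_prod :
    stableAnnihilator A (M × N) = stableAnnihilator A M ⊓ stableAnnihilator A N := by
  refine le_antisymm (le_inf ?_ ?_) fun x hx => ?_
  · exact stableAnnihilator_le_of_retract (LinearMap.inl A M N) (LinearMap.fst A M N) (by ext; simp)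
  · exact stableAnnihilator_le_of_retract (LinearMap.inr A M N) (LinearMap.snd A M N) (by ext; simp)
  · rw [mem_stableAnnihilator]
    have h : (x • LinearMap.id : (M × N) →ₗ[A] M × N) =
        LinearMap.inl A M N ∘ₗ (x • LinearMap.id) ∘ₗ LinearMap.fst A M N +
          LinearMap.inr A M N ∘ₗ (x • LinearMap.id) ∘ₗ LinearMap.snd A M N := by
      ext <;> simp
    rw [h]
    exact add_mem (conj_mem_factoringThrough _ _ hx.1) (conj_mem_factoringThrough _ _ hx.2)

/-- Multiplication by `x` on `M` maps the distinguished element `z` into `I M` if it factors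
through a free module, because a functional on `M` maps `z` into `Q : I = I`. -/
lemma IsUlrichSyzygy.stableAnnihilator_eq {I : Ideal A} {rs : List A}
    (hM : IsUlrichSyzygy I (Ideal.ofList []) rs M)
    (hcolon : ∀ y, (∀ x ∈ I, y * x ∈ Ideal.ofList rs) → y ∈ I) : stableAnnihilator A M = I := by
  refine le_antisymm (fun x hx => ?_) fun x hx =>
    factoringThrough_le_of_linearEquiv (Submodule.quotEquivOfEqBot _ Ideal.ofList_nil)
      (hM.smul_id_mem x hx)
  obtain ⟨z, f, hfz, hIz⟩ := hM.exists_splitting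
  have key : ∀ φ ∈ factoringThrough A A M, f (φ z) = 0 := by
    intro φ hφ
    induction hφ using Submodule.span_induction with
    | mem φ h =>
      obtain ⟨α, β, rfl⟩ := h
      have hα : α z ∈ I := hcolon _ fun x hx => by
        have h1 := Submodule.mem_map_of_mem (f := α) (hIz x hx)
        rw [Submodule.map_smul''] at h1
        have h2 : α (x • z) ∈ Ideal.ofList rs := Ideal.mul_le_left (J := Submodule.map α ⊤) h1
        rwa [map_smul, smul_eq_mul, mul_comm] at h2
      have h1 : β (α z) = α z • β 1 := by rw [← map_smul, smul_eq_mul, mul_one]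
      rw [LinearMap.comp_apply, h1, map_smul]
      obtain ⟨t, ht⟩ := Submodule.Quotient.mk_surjective _ (f (β 1))
      rw [← ht, ← Submodule.Quotient.mk_smul, Submodule.Quotient.mk_eq_zero]
      exact I.mul_mem_right _ hα
    | zero => simp
    | add φ ψ _ _ h1 h2 => simp [h1, h2]
    | smul c φ _ h => simp [h]
  have h1 := key _ (mem_stableAnnihilator.1 hx)
  rw [LinearMap.smul_apply, LinearMap.id_apply, map_smul, hfz] at h1
  have h2 : x • (1 : A ⧸ I) = Ideal.Quotient.mk I x := by
    rw [Algebra.smul_def, mul_one]; rfl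
  rw [h2] at h1
  exact Ideal.Quotient.eq_zero_iff_mem.1 h1

end StableAnnihilator

/-! ### Decomposition of maximal Cohen–Macaulay modules -/

section MaximalCohenMacaulay

open RingTheory.Sequence IsLocalRing

variable {A : Type u} [CommRing A] [IsLocalRing A]

lemma exists_isWeaklyRegular_of_depth_eq {M : Type u} [AddCommGroup M] [Module A M] {d : ℕ}
    (h : depth A M = d) :
    ∃ rs : List A, rs.length = d ∧ (∀ r ∈ rs, r ∈ maximalIdeal A) ∧ IsWeaklyRegular M rs := by
  obtain _ | e := d
  · exact ⟨[], rfl, by simp, .nil A M⟩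
  have hlt : (e : ℕ∞) < depth A M := by rw [h]; exact_mod_cast e.lt_succ_self
  simp only [depth, lt_iSup_iff] at hlt
  obtain ⟨rs, hrs, hlt⟩ := hlt
  have hle : (rs.length : ℕ∞) ≤ depth A M := le_iSup₂_of_le rs hrs le_rfl
  rw [h] at hle
  have h1 : e < rs.length := by exact_mod_cast hlt
  have h2 : rs.length ≤ e + 1 := by exact_mod_cast hle
  exact ⟨rs, by omega, hrs.1, hrs.2.toIsWeaklyRegular⟩

lemma isMaximalCohenMacaulay_of_isWeaklyRegular [IsNoetherianRing A] {M : Type u} [AddCommGroup M]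
    [Module A M] [Module.Finite A M] [Nontrivial M] {rs : List A}
    (hdim : (rs.length : WithBot ℕ∞) = ringKrullDim A) (hmem : ∀ r ∈ rs, r ∈ maximalIdeal A)
    (hrs : IsWeaklyRegular M rs) : IsMaximalCohenMacaulay A M := by
  refine ⟨inferInstance, inferInstance, le_antisymm ?_ ?_⟩
  · rw [← hdim]
    suffices depth A M ≤ rs.length by exact_mod_cast this
    refine iSup₂_le fun ts hts => ?_
    have h1 := Module.supportDim_add_length_eq_supportDim_of_isRegular ts hts.2
    have h2 := Module.supportDim_le_ringKrullDim A M
    have := hts.2.quot_ofList_smul_nontrivial ⊤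
    have h3 : (0 : WithBot ℕ∞) ≤
        Module.supportDim A (M ⧸ Ideal.ofList ts • (⊤ : Submodule A M)) := by
      obtain ⟨n, hn⟩ := WithBot.ne_bot_iff_exists.1
        (Module.supportDim_ne_bot_of_nontrivial A (M ⧸ Ideal.ofList ts • (⊤ : Submodule A M)))
      rw [← hn]
      exact_mod_cast zero_le
    have h4 : (ts.length : WithBot ℕ∞) ≤ rs.length := by
      rw [hdim]
      refine le_trans ?_ (h1.le.trans h2)
      exact le_add_of_nonneg_left h3
    exact_mod_cast h4
  · rw [← hdim]
    have hreg : IsRegular M rs := .of_isWeaklyRegular_of_mem_maximalIdeal M hmem hrs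
    have : (rs.length : ℕ∞) ≤ depth A M := le_iSup₂_of_le rs ⟨hmem, hreg⟩ le_rfl
    exact_mod_cast this

lemma IsMaximalCohenMacaulay.of_retract [IsNoetherianRing A] {M N : Type u} [AddCommGroup M]
    [Module A M] [AddCommGroup N] [Module A N] [Nontrivial N] (hM : IsMaximalCohenMacaulay A M)
    (s : N →ₗ[A] M) (r : M →ₗ[A] N) (h : r ∘ₗ s = LinearMap.id) : IsMaximalCohenMacaulay A N := by
  have := hM.finite
  have : Module.Finite A N := .of_surjective r fun x => ⟨s x, LinearMap.congr_fun h x⟩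
  obtain ⟨d, hd⟩ : ∃ d : ℕ, (d : WithBot ℕ∞) = ringKrullDim A := by
    have hne : depth A M ≠ ⊤ := fun h =>
      ringKrullDim_ne_top (R := A) (by rw [← hM.depth_eq, h]; rfl)
    obtain ⟨d, hd⟩ := ENat.ne_top_iff_exists.1 hne
    exact ⟨d, by rw [← hM.depth_eq, ← hd]; rfl⟩
  have hdepth : depth A M = d := by
    have := hM.depth_eq
    rw [← hd] at this
    exact_mod_cast this
  obtain ⟨rs, hlen, hmem, hrs⟩ := exists_isWeaklyRegular_of_depth_eq hdepth
  exact isMaximalCohenMacaulay_of_isWeaklyRegular (by rw [hlen, hd]) hmem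
    (isWeaklyRegular_of_retract s r h hrs)

/-- A maximal Cohen–Macaulay module is a direct sum of indecomposable ones, so its stable
annihilator is an intersection of stable annihilators of indecomposable ones. -/
lemma exists_stableAnnihilator_eq_sInf [IsNoetherianRing A] {S : Set (ModuleCat.{u} A)}
    (hS : ∀ M : ModuleCat.{u} A, IsMaximalCohenMacaulay A M → Indecomposable M →
      ∃ N ∈ S, Nonempty (M ≅ N))
    {M : Type u} [AddCommGroup M] [Module A M] (hM : IsMaximalCohenMacaulay A M) :
    ∃ T ⊆ S, stableAnnihilator A M =
      sInf ((fun N : ModuleCat.{u} A => stableAnnihilator A N) '' T) := by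
  have := hM.finite
  -- induction on the kernel of a surjection from `M`
  suffices h : ∀ (K : Submodule A M) (X : ModuleCat.{u} A) (p : M →ₗ[A] X),
      Function.Surjective p → LinearMap.ker p = K → IsMaximalCohenMacaulay A X →
      ∃ T ⊆ S, stableAnnihilator A X =
        sInf ((fun N : ModuleCat.{u} A => stableAnnihilator A N) '' T) from
    h ⊥ (ModuleCat.of A M) LinearMap.id Function.surjective_id LinearMap.ker_id hM
  intro K
  induction K using IsNoetherian.induction with
  | hgt K ih =>
    intro X p hp hK hX
    by_cases hind : Indecomposable X
    · obtain ⟨N, hN, ⟨e⟩⟩ := hS X hX hind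
      refine ⟨{N}, by simpa using hN, ?_⟩
      rw [Set.image_singleton, sInf_singleton]
      exact stableAnnihilator_congr e.toLinearEquiv
    · have hX0 : ¬ Limits.IsZero X := fun h =>
        not_subsingleton_iff_nontrivial.2 hX.nontrivial (ModuleCat.isZero_iff_subsingleton.1 h)
      simp only [Indecomposable, hX0, not_false_eq_true, true_and, not_forall, not_or] at hind
      obtain ⟨Y, Z, e, hY, hZ⟩ := hind
      have hY' : Nontrivial Y := by
        rwa [ModuleCat.isZero_iff_subsingleton, not_subsingleton_iff_nontrivial] at hY
      have hZ' : Nontrivial Z := by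
        rwa [ModuleCat.isZero_iff_subsingleton, not_subsingleton_iff_nontrivial] at hZ
      let e' : X ≃ₗ[A] Y × Z := (e ≪≫ ModuleCat.biprodIsoProd Y Z).toLinearEquiv
      let q := e'.toLinearMap ∘ₗ p
      have hq : Function.Surjective q := e'.surjective.comp hp
      have hle : ∀ {W : Type u} [AddCommGroup W] [Module A W] (f : Y × Z →ₗ[A] W) (w : Y × Z),
          w ≠ 0 → f w = 0 → LinearMap.ker (f ∘ₗ q) > K := by
        intro W _ _ f w hw hfw
        obtain ⟨m, hm⟩ := hq w
        refine lt_of_le_of_ne (fun x hx => ?_) fun heq => ?_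
        · rw [← hK] at hx
          simp [q, LinearMap.mem_ker.1 hx]
        · have : m ∈ K := by
            rw [heq, LinearMap.mem_ker, LinearMap.comp_apply, hm, hfw]
          rw [← hK] at this
          apply hw
          rw [← hm]
          simp [q, LinearMap.mem_ker.1 this]
      obtain ⟨y, hy⟩ := exists_ne (0 : Y)
      obtain ⟨z, hz⟩ := exists_ne (0 : Z)
      obtain ⟨T, hT, hTY⟩ := ih _ (hle (LinearMap.fst A Y Z) (0, z) (by simpa using hz) rfl) Y
        (LinearMap.fst A Y Z ∘ₗ q) (Prod.fst_surjective.comp hq) rfl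
        (hX.of_retract (e'.symm.toLinearMap ∘ₗ LinearMap.inl A Y Z)
          (LinearMap.fst A Y Z ∘ₗ e'.toLinearMap) (by ext; simp))
      obtain ⟨T', hT', hTZ⟩ := ih _ (hle (LinearMap.snd A Y Z) (y, 0) (by simpa using hy) rfl) Z
        (LinearMap.snd A Y Z ∘ₗ q) (Prod.snd_surjective.comp hq) rfl
        (hX.of_retract (e'.symm.toLinearMap ∘ₗ LinearMap.inr A Y Z)
          (LinearMap.snd A Y Z ∘ₗ e'.toLinearMap) (by ext; simp))
      refine ⟨T ∪ T', Set.union_subset hT hT', ?_⟩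
      rw [stableAnnihilator_congr e', stableAnnihilator_prod, hTY, hTZ, Set.image_union, sInf_union]

end MaximalCohenMacaulay

/-! ### Ulrich ideals as stable annihilators -/

section UlrichIdeals

open RingTheory.Sequence IsLocalRing

/-- Every Ulrich ideal that is not a parameter ideal is the stable annihilator of a maximal
Cohen–Macaulay module. -/
lemma exists_stableAnnihilator_eq {A : Type u} [CommRing A] [IsLocalRing A]
    (hA : IsCohenMacaulayLocal A) {I : Ideal A} (hI : I ∈ nonparameterUlrichIdeals A) :
    ∃ (M : Type u) (_ : AddCommGroup M) (_ : Module A M),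
      IsMaximalCohenMacaulay A M ∧ stableAnnihilator A M = I := by
  classical
  have := hA.noetherian
  obtain ⟨⟨hrad, ⟨Q, ⟨hQrad, d, hd, a, rfl⟩, ⟨hQI, -⟩, hI2⟩, hfree⟩, hrank⟩ := hI
  have haI : ∀ i, a i ∈ I := fun i => hQI (Ideal.subset_span ⟨i, rfl⟩)
  have hIm : I ≤ maximalIdeal A := hrad ▸ Ideal.le_radical
  have hlist : Ideal.ofList (List.ofFn a) = Ideal.span (Set.range a) := by
    simp only [Ideal.ofList, List.mem_ofFn']; rfl
  have hdepth : depth A A = d := by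
    have := hA.depth_eq
    rw [← hd] at this
    exact_mod_cast this
  have hmem : ∀ r ∈ List.ofFn a, r ∈ I := fun r hr => by
    obtain ⟨i, rfl⟩ := List.mem_ofFn.1 hr
    exact haI i
  obtain ⟨rs, hlen, hrsm, hrs⟩ := exists_isWeaklyRegular_of_depth_eq hdepth
  have ha : IsWeaklyRegular A (List.ofFn a) :=
    isWeaklyRegular_of_system_of_parameters _ (by simpa using hlen) hrsm hrs
      (fun r hr => hIm (hmem r hr)) <| by
        rw [hlist, ← hQrad]
        exact Ideal.radical_mono le_sup_left
  have hne : I ≠ Ideal.span (Set.range a) := by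
    intro h
    have h1 : I.spanFinrank ≤ d := by
      rw [h]
      refine (Submodule.spanFinrank_span_le_ncard_of_finite (Set.finite_range a)).trans ?_
      rw [← Set.image_univ]
      refine (Set.ncard_image_le Set.finite_univ).trans ?_
      simp [Set.ncard_univ]
    rw [← hd] at hrank
    exact absurd h1 (not_le.2 (by exact_mod_cast hrank))
  obtain ⟨⟨ρ, hρ⟩, hcolon⟩ := exists_dual_and_colon_le hrad ha haI hI2
  obtain ⟨M, _, _, hM⟩ := exists_isUlrichSyzygy (List.ofFn a) [] hmem hIm ha
    fun l l' x hx hl => by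
      rw [List.nil_append] at hl
      -- the `i`-th functional, where `i` is the number of preceding members
      have hlen : l.length < d := by
        have := congrArg List.length hl
        simp at this
        omega
      have hget : ∀ j (hj : j < d), (l ++ x :: l')[j]? = some (a ⟨j, hj⟩) := fun j hj => by
        rw [← hl]; simp [hj]
      have hxa : x = a ⟨l.length, hlen⟩ := by simpa using hget _ hlen
      subst hxa
      refine ⟨LinearMap.proj ⟨l.length, hlen⟩ ∘ₗ ρ, by simp [hρ], fun y hy => ?_⟩
      -- the ideal generated by the preceding members lies in the kernel of the functional
      have hker : Ideal.ofList l ≤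
          (LinearMap.ker (LinearMap.proj ⟨l.length, hlen⟩ ∘ₗ ρ)).map I.subtype := by
        refine Ideal.span_le.2 fun r hr => ?_
        obtain ⟨j, hj, rfl⟩ := List.getElem_of_mem hr
        have hja : l[j] = a ⟨j, hj.trans hlen⟩ := by
          have := hget j (hj.trans hlen)
          rw [List.getElem?_append_left hj, List.getElem?_eq_getElem hj] at this
          exact Option.some.inj this
        rw [hja]
        refine ⟨⟨_, haI _⟩, ?_, rfl⟩
        rw [SetLike.mem_coe, LinearMap.mem_ker, LinearMap.comp_apply, hρ, LinearMap.proj_apply,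
          Pi.single_eq_of_ne]
        exact fun h => hj.ne' (congrArg Fin.val h)
      obtain ⟨y', hy', hyy⟩ := hker hy
      obtain rfl : y' = y := Subtype.ext hyy
      exact hy'
  have := hM.finite
  have hnt : Nontrivial M := by
    obtain ⟨z, f, hfz, -⟩ := hM.exists_splitting
    have : Nontrivial (A ⧸ I) := Ideal.Quotient.nontrivial_iff.2 fun h =>
      (maximalIdeal.isMaximal A).ne_top (top_le_iff.1 (h ▸ hIm))
    refine ⟨z, 0, fun h => one_ne_zero (α := A ⧸ I) ?_⟩
    rw [← hfz, h, map_zero]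
  refine ⟨M, _, _, isMaximalCohenMacaulay_of_isWeaklyRegular (by simpa using hd)
    (fun r hr => hIm (hmem r hr)) hM.isWeaklyRegular, hM.stableAnnihilator_eq ?_⟩
  rw [hlist]
  exact hcolon hne

end UlrichIdeals

end UlrichFinite

theorem theorem7p7 (A : Type u) [CommRing A] [IsLocalRing A]
    (hA : UlrichFinite.IsCohenMacaulayLocal A) (hfin : UlrichFinite.HasFiniteCMType A) :
    (UlrichFinite.nonparameterUlrichIdeals A).Finite := by
  have := hA.noetherian
  obtain ⟨S, hSfin, hS⟩ := hfin
  refine (hSfin.finite_subsets.image fun T =>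
    sInf ((fun N : ModuleCat.{u} A => UlrichFinite.stableAnnihilator A N) '' T)).subset ?_
  intro I hI
  obtain ⟨M, _, _, hM, rfl⟩ := UlrichFinite.exists_stableAnnihilator_eq hA hI
  obtain ⟨T, hT, h⟩ := UlrichFinite.exists_stableAnnihilator_eq_sInf hS hM
  exact ⟨T, hT, h.symm⟩
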